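/- Theorem (Dirichlet polynomials dense in $H(\Omega)$, $\Omega$ simply connected): Let $\Omega\subset\mathbb{C}$ be an open simply connected set, and let $H(\Omega)$ be the space of holomorphic functions $f:\Omega\to\mathbb{C}$, endowed with the topology of uniform convergence on compact subsets of $\Omega$. Then the (restrictions to $\Omega$ of) Dirichlet polynomials, that is, the functions of the form $P(s)=\sum_{n=1}^{N}a_n n^{-s}$ with $N\in\mathbb{N}$ and $a_1,\dots,a_N\in\mathbb{C}$, are dense in $H(\Omega)$. -/

import Mathlib

/-- The space `H(Ω)` of holomorphic functions on a set `Ω ⊆ ℂ` (used for `Ω` open), as a subspace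
of the space `C(Ω, ℂ)` of continuous functions. The topology is the one induced by the compact-open
topology of `C(Ω, ℂ)`, that is, the topology of uniform convergence on compact subsets of `Ω`. -/
def HolomorphicSpace (Ω : Set ℂ) : Submodule ℂ C(Ω, ℂ) where
  carrier := {f | ∃ F : ℂ → ℂ, DifferentiableOn ℂ F Ω ∧ ∀ z : Ω, f z = F z}
  zero_mem' := ⟨fun _ => 0, differentiableOn_const 0, fun _ => rfl⟩
  add_mem' := by
    rintro f g ⟨F, hF, hf⟩ ⟨G, hG, hg⟩
    exact ⟨fun z => F z + G z, hF.add hG, fun z => by simp [hf z, hg z]⟩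
  smul_mem' := by
    rintro c f ⟨F, hF, hf⟩
    exact ⟨fun z => c * F z, hF.const_mul c, fun z => by simp [hf z]⟩

/-- The Dirichlet polynomial `s ↦ ∑_{n=1}^{N} a_n n^{-s}`. -/
noncomputable def dirichletPolynomial (N : ℕ) (a : ℕ → ℂ) (s : ℂ) : ℂ :=
  ∑ n ∈ Finset.Icc 1 N, a n * (n : ℂ) ^ (-s)

/-- The set of (restrictions to `Ω` of) Dirichlet polynomials, inside `H(Ω)`. -/
def dirichletPolynomials (Ω : Set ℂ) : Set (HolomorphicSpace Ω) :=
  {f | ∃ (N : ℕ) (a : ℕ → ℂ), ∀ s : Ω, (f : C(Ω, ℂ)) s = dirichletPolynomial N a s}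

/-! Runge's theorem reduces the density to approximating the monomials `s ^ k` uniformly on a
compact `K`. Suppose a continuous functional `L` on `C(K, ℂ)` kills every `n ^ (-s) = exp (-s log
n)`, `n ≥ 1`. Then `F(t) = L(exp(ts))` is entire of exponential type and vanishes at all points
`-log n`. A disc of radius `log N` contains `N` of them, exponentially many in the radius, which
forces `F = 0` (`eq_zero_of_forall_neg_log_eq_zero`). The derivatives of `F` at `0` are the `L(s ^
k)`, so Hahn-Banach concludes (`pow_mem_closure_span_exp_neg_log`).

For Runge's theorem, simple connectedness keeps the hull of `K` (`K` with its holes filled) inside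
`Ω`: otherwise `z - a` would have a continuous logarithm on a circle around `a`. With a cutoff equal
to `1` near the hull, the Cauchy-Pompeiu formula (`integral_dbar_mul_inv_sub`) writes `f` on `K` as
an integral of kernels `1 / (w - z)` with `w` off the hull, and each kernel is a uniform limit of
polynomials by a spectral argument (`inv_sub_mem_closure_polynomialFunctions`). -/

/-! ### Entire functions of exponential type with too many zeros -/

/-- Zeros of an entire function can be divided out. -/
theorem Differentiable.exists_eq_prod_mul {F : ℂ → ℂ} (S : Finset ℂ) (hF : Differentiable ℂ F)
    (h0 : ∀ a ∈ S, F a = 0) :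
    ∃ G : ℂ → ℂ, Differentiable ℂ G ∧ ∀ z, F z = (∏ a ∈ S, (z - a)) * G z := by
  classical
  induction S using Finset.induction_on with
  | empty => exact ⟨F, hF, by simp⟩
  | insert b S hb ih =>
    obtain ⟨G, hG, hFG⟩ := ih fun a ha => h0 a (Finset.mem_insert_of_mem ha)
    have hGb : G b = 0 := by
      have := hFG b
      rw [h0 b (Finset.mem_insert_self b S)] at this
      refine (mul_eq_zero.mp this.symm).resolve_left (Finset.prod_ne_zero_iff.mpr ?_)
      rintro a ha h
      exact hb (sub_eq_zero.mp h ▸ ha)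
    refine ⟨dslope G b, ?_, fun z => ?_⟩
    · rw [← differentiableOn_univ] at hG ⊢
      exact (Complex.differentiableOn_dslope Filter.univ_mem).mpr hG
    · rw [Finset.prod_insert hb, hFG z, mul_comm (z - b), mul_assoc]
      congr 1
      simpa [hGb] using (sub_smul_dslope G b z).symm

/-- An entire function of exponential type with many zeros is small. -/
theorem norm_le_of_zeros {F : ℂ → ℂ} (hF : Differentiable ℂ F) {C R : ℝ}
    (hC : ∀ z, ‖F z‖ ≤ C * Real.exp (R * ‖z‖)) {S : Finset ℂ} (h0 : ∀ a ∈ S, F a = 0)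
    {r : ℝ} (hr : 0 < r) (hS : ∀ a ∈ S, ‖a‖ ≤ r) {z : ℂ} (hz : ‖z‖ ≤ r) :
    ‖F z‖ ≤ C * Real.exp (R * (5 * r)) * (1 / 2) ^ S.card := by
  obtain ⟨G, hG, hFG⟩ := hF.exists_eq_prod_mul S h0
  have hGz : ‖G z‖ ≤ C * Real.exp (R * (5 * r)) / (4 * r) ^ S.card := by
    -- Maximum principle on radius `5 * r`: there each factor `w - a` has norm at least `4 * r`,
    -- against at most `2 * r` at `z`, so every zero gains a factor `1 / 2`.
    refine Complex.norm_le_of_forall_mem_frontier_norm_le (U := Metric.ball 0 (5 * r))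
      Metric.isBounded_ball hG.diffContOnCl (fun w hw => ?_) (subset_closure ?_)
    · rw [frontier_ball _ (by positivity), mem_sphere_zero_iff_norm] at hw
      rw [le_div_iff₀ (by positivity), ← hw]
      refine le_trans ?_ (hC w)
      rw [hFG w, norm_mul, mul_comm, norm_prod]
      refine mul_le_mul_of_nonneg_right ?_ (norm_nonneg _)
      rw [← Finset.prod_const]
      refine Finset.prod_le_prod (fun _ _ => by positivity) fun a ha => ?_
      have := norm_sub_norm_le w a
      have := hS a ha
      linarith
    · rw [mem_ball_zero_iff]
      linarith
  have hprod : ∏ a ∈ S, ‖z - a‖ ≤ (2 * r) ^ S.card := by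
    rw [← Finset.prod_const]
    refine Finset.prod_le_prod (fun _ _ => norm_nonneg _) fun a ha => ?_
    have := norm_sub_le z a
    have := hS a ha
    linarith
  calc ‖F z‖ = (∏ a ∈ S, ‖z - a‖) * ‖G z‖ := by rw [hFG z, norm_mul, norm_prod]
    _ ≤ (2 * r) ^ S.card * (C * Real.exp (R * (5 * r)) / (4 * r) ^ S.card) :=
      mul_le_mul hprod hGz (norm_nonneg _) (by positivity)
    _ = C * Real.exp (R * (5 * r)) * (1 / 2) ^ S.card := by
      rw [show (4 * r) = 2 * (2 * r) by ring, mul_pow 2 (2 * r), div_pow, one_pow]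
      have : (2 * r) ^ S.card ≠ 0 := by positivity
      field_simp

/-- An entire function of exponential type vanishing at all points `-log n` is zero. -/
theorem eq_zero_of_forall_neg_log_eq_zero {F : ℂ → ℂ} (hF : Differentiable ℂ F) {C R : ℝ}
    (hC : ∀ z, ‖F z‖ ≤ C * Real.exp (R * ‖z‖))
    (h0 : ∀ n : ℕ, F (-(Real.log (n + 1) : ℂ)) = 0) (z : ℂ) : F z = 0 := by
  have hinj : Function.Injective fun n : ℕ => -(Real.log (n + 1) : ℂ) := by
    intro m n h
    have h1 : Real.log (m + 1) = Real.log (n + 1) := by exact_mod_cast neg_injective h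
    have h2 := Real.log_injOn_pos (Set.mem_Ioi.mpr (by positivity : (0 : ℝ) < m + 1))
      (Set.mem_Ioi.mpr (by positivity : (0 : ℝ) < n + 1)) h1
    exact_mod_cast add_right_cancel h2
  -- With `N` zeros in the disc of radius `log N`, the growth factor `exp (5 R log N) = N ^ (5 R)`
  -- is only polynomial in `N` and loses to `(1 / 2) ^ N`.
  have hlim : Filter.Tendsto (fun N : ℕ => C * (((N : ℝ) ^ ⌈5 * R⌉₊) * (1 / 2) ^ N))
      Filter.atTop (nhds 0) := by
    simpa using (tendsto_pow_const_mul_const_pow_of_abs_lt_one ⌈5 * R⌉₊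
      (by norm_num [abs_of_pos] : |(1 / 2 : ℝ)| < 1)).const_mul C
  have hC0 : 0 ≤ C := by
    have := (norm_nonneg _).trans (hC 0)
    simpa using this
  refine norm_le_zero_iff.mp (ge_of_tendsto hlim ?_)
  have hlog : Filter.Tendsto (fun N : ℕ => Real.log N) Filter.atTop Filter.atTop :=
    Real.tendsto_log_atTop.comp tendsto_natCast_atTop_atTop
  filter_upwards [hlog.eventually_ge_atTop ‖z‖, hlog.eventually_gt_atTop 0,
    Filter.eventually_ge_atTop 1] with N hNz hN0 hN1
  have hN1' : (1 : ℝ) ≤ N := by exact_mod_cast hN1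
  have key := norm_le_of_zeros hF hC
    (S := (Finset.range N).map ⟨_, hinj⟩) (r := Real.log N) ?_ hN0 ?_ hNz
  · rw [Finset.card_map, Finset.card_range, mul_assoc] at key
    refine key.trans ?_
    gcongr
    calc Real.exp (R * (5 * Real.log N)) = (N : ℝ) ^ (5 * R) := by
          rw [Real.rpow_def_of_pos (by linarith)]
          ring_nf
      _ ≤ (N : ℝ) ^ ((⌈5 * R⌉₊ : ℕ) : ℝ) := Real.rpow_le_rpow_of_exponent_le hN1' (Nat.le_ceil _)
      _ = _ := Real.rpow_natCast _ _
  · simp only [Finset.mem_map, Function.Embedding.coeFn_mk, forall_exists_index, and_imp]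
    rintro _ n - rfl
    exact h0 n
  · simp only [Finset.mem_map, Function.Embedding.coeFn_mk, forall_exists_index, and_imp,
      Finset.mem_range]
    rintro _ n hn rfl
    rw [norm_neg, Complex.norm_real,
      Real.norm_of_nonneg (Real.log_nonneg (by linarith [n.cast_nonneg (α := ℝ)]))]
    exact Real.log_le_log (by positivity) (by exact_mod_cast hn)

/-! ### Duality and the span of exponentials in a Banach algebra -/

/-- A closed subspace of a normed space is cut out by continuous functionals. -/
theorem Submodule.mem_of_forall_dual {E : Type*} [NormedAddCommGroup E] [NormedSpace ℂ E]
    (S : Submodule ℂ E) (hS : IsClosed (S : Set E)) (x : E)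
    (h : ∀ L : E →L[ℂ] ℂ, (∀ y ∈ S, L y = 0) → L x = 0) : x ∈ S := by
  -- Closedness makes the quotient a normed space, whose dual separates points.
  have := hS
  rw [← Submodule.Quotient.mk_eq_zero S]
  refine SeparatingDual.eq_zero_of_forall_dual_eq_zero (R := ℂ) fun L => ?_
  refine h (L.comp S.mkQL) fun y hy => ?_
  simp [(Submodule.Quotient.mk_eq_zero S).mpr hy]

theorem NormedSpace.norm_exp_le_exp_norm {A : Type*} [NormedRing A] [NormedAlgebra ℂ A]
    [NormOneClass A] (x : A) : ‖NormedSpace.exp x‖ ≤ Real.exp ‖x‖ := by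
  rw [NormedSpace.exp_eq_tsum ℂ, Real.exp_eq_exp_ℝ]
  refine tsum_of_norm_bounded (NormedSpace.expSeries_div_hasSum_exp ‖x‖) fun n => ?_
  rw [norm_smul, norm_inv, Complex.norm_natCast, div_eq_inv_mul]
  gcongr
  exact norm_pow_le x n

open NormedSpace in
/-- The powers of an element `x` of a commutative Banach algebra lie in the closed linear span of
the exponentials `exp (-log n • x)`, `n ≥ 1`. -/
theorem pow_mem_closure_span_exp_neg_log {A : Type*} [NormedCommRing A] [NormedAlgebra ℂ A]
    [NormOneClass A]
    [CompleteSpace A] (x : A) (k : ℕ) :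
    x ^ k ∈ (Submodule.span ℂ
      (Set.range fun n : ℕ => exp (-(Real.log (n + 1) : ℂ) • x))).topologicalClosure := by
  refine Submodule.mem_of_forall_dual _ (Submodule.isClosed_topologicalClosure _) _ fun L hL => ?_
  let _ : NormedAlgebra ℚ A := NormedAlgebra.restrictScalars ℚ ℂ A
  have hderiv (k : ℕ) (t : ℂ) :
      HasDerivAt (fun t : ℂ => L (x ^ k * exp (t • x))) (L (x ^ (k + 1) * exp (t • x))) t := by
    have := L.hasFDerivAt.comp_hasDerivAt t ((hasDerivAt_exp_smul_const' x t).const_mul (x ^ k))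
    rw [← mul_assoc, ← pow_succ] at this
    exact this
  have hzero : ∀ t : ℂ, L (exp (t • x)) = 0 := by
    refine eq_zero_of_forall_neg_log_eq_zero (C := ‖L‖) (R := ‖x‖) (fun t => ?_) (fun t => ?_)
      fun n => ?_
    · simpa using (hderiv 0 t).differentiableAt
    · refine (L.le_opNorm _).trans (mul_le_mul_of_nonneg_left ?_ (norm_nonneg _))
      refine (NormedSpace.norm_exp_le_exp_norm _).trans (Real.exp_le_exp.mpr ?_)
      rw [norm_smul, mul_comm]
    · exact hL _ (Submodule.le_topologicalClosure _ (Submodule.subset_span ⟨n, rfl⟩))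
  have hall (k : ℕ) : ∀ t : ℂ, L (x ^ k * exp (t • x)) = 0 := by
    induction k with
    | zero => simpa using hzero
    | succ k ih =>
      intro t
      -- The value at `k + 1` is the derivative of a function that is identically zero by induction.
      refine (hderiv k t).unique ?_
      simp only [ih]
      exact hasDerivAt_const t 0
  simpa using hall k 0

/-! ### Simple connectedness and filling the holes of a compact set -/

/-- There is no continuous logarithm of `z - a` on a circle centred at `a`. -/
theorem not_exp_eq_sub_on_sphere {l : ℂ → ℂ} (hl : Continuous l) (a : ℂ) {r : ℝ} (hr : 0 < r)
    (h : ∀ z ∈ Metric.sphere a r, Complex.exp (l z) = z - a) : False := by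
  -- The gap between the imaginary part of the logarithm and the angle, in turns: integer-valued and
  -- continuous, yet it drops by `1` over a full turn, so it would take a half-integer value.
  set κ : ℝ → ℝ := fun θ => ((l (circleMap a r θ)).im - θ) / (2 * Real.pi) with hκ
  have hκc : Continuous κ := by fun_prop
  have hint (θ : ℝ) : ∃ n : ℤ, κ θ = n := by
    have h1 := h _ (circleMap_mem_sphere a hr.le θ)
    have h2 : Complex.exp (l (circleMap a r θ)) = Complex.exp (Real.log r + θ * Complex.I) := by
      rw [h1, Complex.exp_add, ← Complex.ofReal_exp, Real.exp_log hr, circleMap_sub_center,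
        circleMap_zero]
    obtain ⟨n, hn⟩ := Complex.exp_eq_exp_iff_exists_int.mp h2
    refine ⟨n, ?_⟩
    have h3 := congrArg Complex.im hn
    simp only [Complex.add_im, Complex.ofReal_im, Complex.mul_im, Complex.ofReal_re, Complex.I_im,
      Complex.I_re, Complex.intCast_re, Complex.intCast_im, Complex.mul_re, Complex.re_ofNat,
      Complex.im_ofNat] at h3
    rw [hκ]
    simp only [h3]
    field_simp
    ring
  have hper : κ (2 * Real.pi) = κ 0 - 1 := by
    have : circleMap a r (2 * Real.pi) = circleMap a r 0 := by simp [circleMap]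
    simp only [hκ, this]
    field_simp
    ring
  obtain ⟨n, hn⟩ := hint 0
  obtain ⟨θ, hθ⟩ := mem_range_of_exists_le_of_exists_ge hκc
    ⟨2 * Real.pi, (by linarith : κ (2 * Real.pi) ≤ κ 0 - 1 / 2)⟩
    ⟨0, (by linarith : κ 0 - 1 / 2 ≤ κ 0)⟩
  obtain ⟨m, hm⟩ := hint θ
  have : (2 * m : ℝ) = 2 * n - 1 := by linarith
  have : 2 * m = 2 * n - 1 := by exact_mod_cast this
  omega

theorem frontier_connectedComponentIn_compl_subset {X : Type*} [TopologicalSpace X]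
    [LocallyConnectedSpace X] {K : Set X} (hK : IsClosed K) (a : X) :
    frontier (connectedComponentIn Kᶜ a) ⊆ K := by
  intro x hx
  by_contra hxK
  have hopen (y : X) : IsOpen (connectedComponentIn Kᶜ y) := hK.isOpen_compl.connectedComponentIn
  obtain ⟨y, hy, hya⟩ := mem_closure_iff.mp hx.1 _ (hopen x) (mem_connectedComponentIn hxK)
  have : connectedComponentIn Kᶜ x = connectedComponentIn Kᶜ a :=
    (connectedComponentIn_eq hy).trans (connectedComponentIn_eq hya).symm
  refine hx.2 ?_
  rw [(hopen a).interior_eq, ← this]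
  exact mem_connectedComponentIn hxK

/-- A bounded component of the complement of a compact subset of an open simply connected set `Ω`
is contained in `Ω`. -/
theorem IsSimplyConnected.not_isBounded_connectedComponentIn {Ω K : Set ℂ} (hΩ : IsOpen Ω)
    (hsc : IsSimplyConnected Ω) (hK : IsCompact K) (hKΩ : K ⊆ Ω) {a : ℂ} (ha : a ∉ Ω) :
    ¬ Bornology.IsBounded (connectedComponentIn Kᶜ a) := by
  classical
  intro hb
  set U := connectedComponentIn Kᶜ a with hU
  have haU : a ∈ U := mem_connectedComponentIn fun h => ha (hKΩ h)
  have hfr : frontier U ⊆ K := frontier_connectedComponentIn_compl_subset hK.isClosed a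
  obtain ⟨g, hgc, hg⟩ := Complex.exists_continuousOn_eqOn_exp_comp hsc hΩ
    (g := fun z => z - a) (by fun_prop) (by
      rintro ⟨z, hz, hza⟩
      exact ha (sub_eq_zero.mp hza ▸ hz))
  -- Tietze: the logarithm of `z - a`, restricted to `K`, extends to the whole plane.
  obtain ⟨G, hG⟩ := ContinuousMap.exists_restrict_eq hK.isClosed
    ⟨K.domRestrict g, continuousOn_iff_continuous_domRestrict.mp (hgc.mono hKΩ)⟩
  have hGg (z : ℂ) (hz : z ∈ K) : G z = g z := congrArg (fun f : C(K, ℂ) => f ⟨z, hz⟩) hG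
  -- Since the frontier of `U` lies in `K`, the two pieces agree there. The glued function has no
  -- zero, because `a ∈ U`, and it equals `z - a` outside the bounded set `U`.
  have hcont : Continuous (U.piecewise (fun z => Complex.exp (G z)) fun z => z - a) := by
    refine Continuous.piecewise (fun z hz => ?_) (by fun_prop) (by fun_prop)
    rw [hGg z (hfr hz)]
    exact hg (hKΩ (hfr hz))
  obtain ⟨l, hlc, hl⟩ := Complex.exists_continuousOn_eqOn_exp_comp (U := (Set.univ : Set ℂ))
    ((Homeomorph.Set.univ ℂ).toHomotopyEquiv.simplyConnectedSpace_iff.mpr inferInstance)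
    isOpen_univ hcont.continuousOn (by
      rintro ⟨z, -, hz⟩
      by_cases hzU : z ∈ U
      · simp [hzU] at hz
      · simp only [hzU, not_false_eq_true, Set.piecewise_eq_of_notMem] at hz
        exact hzU (sub_eq_zero.mp hz ▸ haU))
  obtain ⟨r, hr, hUr⟩ := hb.subset_ball_lt 0 a
  refine not_exp_eq_sub_on_sphere (continuousOn_univ.mp hlc) a hr fun z hz => ?_
  have hzU : z ∉ U := fun h => (Metric.mem_ball.mp (hUr h)).ne hz
  simpa [hzU] using hl (Set.mem_univ z)

/-- The union of `K` and the bounded components of its complement. -/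
def polynomialHull (K : Set ℂ) : Set ℂ :=
  {z | Bornology.IsBounded (connectedComponentIn Kᶜ z)}

theorem subset_polynomialHull (K : Set ℂ) : K ⊆ polynomialHull K := fun z hz => by
  simp [polynomialHull, connectedComponentIn_eq_empty (show z ∉ Kᶜ by simpa)]

theorem isCompact_polynomialHull {K : Set ℂ} (hK : IsCompact K) :
    IsCompact (polynomialHull K) := by
  refine Metric.isCompact_of_isClosed_isBounded ?_ ?_
  · rw [← isOpen_compl_iff, isOpen_iff_forall_mem_open]
    intro z hz
    have hzK : z ∈ Kᶜ := fun h => hz (subset_polynomialHull K h)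
    refine ⟨connectedComponentIn Kᶜ z, fun w hw hw' => hz ?_,
      hK.isClosed.isOpen_compl.connectedComponentIn, mem_connectedComponentIn hzK⟩
    rw [polynomialHull, Set.mem_ofPred_eq, connectedComponentIn_eq hw]
    exact hw'
  · obtain ⟨r, hr, hKr⟩ := hK.isBounded.subset_ball_lt 0 0
    refine Metric.isBounded_ball.subset (t := Metric.ball 0 r) fun z hz => ?_
    by_contra hzr
    rw [mem_ball_zero_iff, not_lt] at hzr
    -- The outward ray from a point outside a disc containing `K` misses `K`, so its component is
    -- unbounded.
    have hsub : (fun t : ℝ => (t : ℂ) * z) '' Set.Ici 1 ⊆ connectedComponentIn Kᶜ z := by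
      refine IsPreconnected.subset_connectedComponentIn ?_ ⟨1, Set.self_mem_Ici, by simp⟩ ?_
      · exact isPreconnected_Ici.image _ (by fun_prop)
      · rintro _ ⟨t, ht, rfl⟩ htK
        have h1 := mem_ball_zero_iff.mp (hKr htK)
        rw [Set.mem_Ici] at ht
        rw [norm_mul, Complex.norm_real, Real.norm_of_nonneg (by linarith)] at h1
        nlinarith
    obtain ⟨B, hB⟩ := (Bornology.IsBounded.subset
      (show Bornology.IsBounded (connectedComponentIn Kᶜ z) from hz) hsub).exists_norm_le
    have h2 := hB _ ⟨max 1 ((B + 1) / r), Set.mem_Ici.mpr (le_max_left _ _), rfl⟩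
    rw [norm_mul, Complex.norm_real, Real.norm_of_nonneg (by positivity)] at h2
    have h3 : (B + 1) / r * r ≤ max 1 ((B + 1) / r) * ‖z‖ := by gcongr; exact le_max_right _ _
    rw [div_mul_cancel₀ _ hr.ne'] at h3
    linarith

theorem IsSimplyConnected.polynomialHull_subset {Ω K : Set ℂ} (hΩ : IsOpen Ω)
    (hsc : IsSimplyConnected Ω) (hK : IsCompact K) (hKΩ : K ⊆ Ω) : polynomialHull K ⊆ Ω :=
  fun _ hz => by_contra fun ha => hsc.not_isBounded_connectedComponentIn hΩ hK hKΩ ha hz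

/-! ### The Cauchy-Pompeiu formula -/

open MeasureTheory in
theorem integral_fderiv_apply_eq_zero {g : ℂ → ℂ} (hg : ContDiff ℝ 1 g) (hc : HasCompactSupport g)
    (v : ℂ) : ∫ w, fderiv ℝ g w v = 0 := by
  have hint : Integrable fun w => fderiv ℝ g w v :=
    ((hg.continuous_fderiv one_ne_zero).clm_apply continuous_const).integrable_of_hasCompactSupport
      (hc.fderiv_apply (𝕜 := ℝ) v)
  have := integral_mul_fderiv_eq_neg_fderiv_mul_of_integrable (𝕜 := ℂ) (μ := (volume : Measure ℂ))
    (f := fun _ => (1 : ℂ)) (g := g) (v := v) (by simp) (by simpa using hint)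
    (by simpa using hg.continuous.integrable_of_hasCompactSupport hc) (by simp)
    (fun x _ => hg.differentiable one_ne_zero x)
  simpa using this

/-- Twice the Wirtinger derivative `∂g/∂z̄`. -/
noncomputable def dbar (g : ℂ → ℂ) (w : ℂ) : ℂ :=
  fderiv ℝ g w 1 + Complex.I * fderiv ℝ g w Complex.I

theorem continuous_dbar {g : ℂ → ℂ} (hg : ContDiff ℝ 1 g) : Continuous (dbar g) := by
  have := hg.continuous_fderiv one_ne_zero
  unfold dbar
  fun_prop

theorem dbar_eq_zero_of_notMem_tsupport {g : ℂ → ℂ} {w : ℂ} (hw : w ∉ tsupport g) :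
    dbar g w = 0 := by
  have : fderiv ℝ g w = 0 :=
    Function.notMem_support.mp fun h => hw (support_fderiv_subset ℝ h)
  simp [dbar, this]

theorem dbar_congr {f g : ℂ → ℂ} {w : ℂ} (h : f =ᶠ[nhds w] g) : dbar f w = dbar g w := by
  rw [dbar, h.fderiv_eq, dbar]

theorem dbar_const (c w : ℂ) : dbar (fun _ => c) w = 0 := by simp [dbar]

theorem tsupport_dbar_subset (g : ℂ → ℂ) : tsupport (dbar g) ⊆ tsupport g :=
  closure_minimal (fun _ hw => by_contra fun h => hw (dbar_eq_zero_of_notMem_tsupport h))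
    (isClosed_tsupport g)

theorem HasCompactSupport.dbar {g : ℂ → ℂ} (hc : HasCompactSupport g) :
    HasCompactSupport (dbar g) :=
  hc.mono' (subset_closure.trans (tsupport_dbar_subset g))

open MeasureTheory in
theorem integral_dbar_eq_zero {g : ℂ → ℂ} (hg : ContDiff ℝ 1 g) (hc : HasCompactSupport g) :
    ∫ w, dbar g w = 0 := by
  have hint (v : ℂ) : Integrable fun w => fderiv ℝ g w v :=
    ((hg.continuous_fderiv one_ne_zero).clm_apply continuous_const).integrable_of_hasCompactSupport
      (hc.fderiv_apply (𝕜 := ℝ) v)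
  unfold dbar
  rw [integral_add (hint 1) ((hint Complex.I).const_mul _), integral_const_mul,
    integral_fderiv_apply_eq_zero hg hc, integral_fderiv_apply_eq_zero hg hc]
  simp

theorem dbar_sub {f g : ℂ → ℂ} {w : ℂ} (hf : DifferentiableAt ℝ f w)
    (hg : DifferentiableAt ℝ g w) : dbar (fun w => f w - g w) w = dbar f w - dbar g w := by
  have : fderiv ℝ (fun w => f w - g w) w = fderiv ℝ f w - fderiv ℝ g w := fderiv_fun_sub hf hg
  simp only [dbar, this, sub_apply]
  ring

theorem dbar_mul_of_differentiableAt {f g : ℂ → ℂ} {w : ℂ} (hf : DifferentiableAt ℝ f w)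
    (hg : DifferentiableAt ℂ g w) : dbar (fun w => f w * g w) w = dbar f w * g w := by
  have h1 := (hf.hasFDerivAt.mul (hg.hasFDerivAt.restrictScalars ℝ)).fderiv
  have h2 : fderiv ℂ g w Complex.I = Complex.I * fderiv ℂ g w 1 := by
    simp
  simp only [dbar]
  change fderiv ℝ (fun w => f w * g w) w = _ at h1
  rw [h1]
  simp only [add_apply, smul_apply, smul_eq_mul,
    ContinuousLinearMap.coe_restrictScalars', h2]
  linear_combination f w * fderiv ℂ g w 1 * Complex.I_mul_I

/-- A radial smooth cutoff function, equal to `1` near the origin. -/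
noncomputable def radialCutoff (v : ℂ) : ℂ := (Real.smoothTransition (2 - Complex.normSq v) : ℂ)

theorem contDiff_normSq : ContDiff ℝ 1 (fun v : ℂ => Complex.normSq v) := by
  simp only [Complex.normSq_eq_norm_sq]
  exact contDiff_norm_sq ℝ

theorem contDiff_radialCutoff : ContDiff ℝ 1 radialCutoff :=
  Complex.ofRealCLM.contDiff.comp
    (Real.smoothTransition.contDiff.comp (contDiff_const.sub contDiff_normSq))

theorem radialCutoff_eventuallyEq_one : radialCutoff =ᶠ[nhds 0] fun _ => 1 := by
  have : ∀ᶠ v : ℂ in nhds 0, Complex.normSq v < 1 :=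
    Complex.continuous_normSq.continuousAt.eventually_lt continuousAt_const (by simp)
  filter_upwards [this] with v hv
  simp [radialCutoff, Real.smoothTransition.one_of_one_le (show 1 ≤ 2 - Complex.normSq v by linarith)]

theorem hasCompactSupport_radialCutoff : HasCompactSupport radialCutoff := by
  refine HasCompactSupport.intro (isCompact_closedBall 0 2) fun v hv => ?_
  rw [mem_closedBall_zero_iff, not_le] at hv
  have : 2 - Complex.normSq v ≤ 0 := by
    rw [Complex.normSq_eq_norm_sq]
    nlinarith
  simp [radialCutoff, Real.smoothTransition.zero_of_nonpos this]

/-- Twice the Wirtinger derivative of `|v|²` is `2v`. The factor `v` later cancels the Cauchy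
kernel, so no singular integral occurs. -/
theorem dbar_radialCutoff (v : ℂ) :
    dbar radialCutoff v =
      ((-2 * deriv Real.smoothTransition (2 - Complex.normSq v) : ℝ) : ℂ) * v := by
  have h1 : HasDerivAt Real.smoothTransition
      (deriv Real.smoothTransition (2 - Complex.normSq v)) (2 - Complex.normSq v) :=
    ((Real.smoothTransition.contDiff (n := 1)).differentiable one_ne_zero _).hasDerivAt
  have h2 : HasFDerivAt (fun v : ℂ => 2 - Complex.normSq v)
      (-((2 * v.re) • Complex.reCLM + (2 * v.im) • Complex.imCLM)) v := by
    have hre := Complex.reCLM.hasFDerivAt (x := v)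
    have him := Complex.imCLM.hasFDerivAt (x := v)
    have := ((hre.mul hre).add (him.mul him)).const_sub 2
    convert! this using 1
    simp only [Complex.reCLM_apply, Complex.imCLM_apply, two_mul, add_smul]
  have h3 := (Complex.ofRealCLM.hasFDerivAt.comp v (h1.comp_hasFDerivAt v h2)).fderiv
  change fderiv ℝ radialCutoff v = _ at h3
  simp only [dbar, h3]
  simp
  set d := deriv Real.smoothTransition (2 - Complex.normSq v)
  conv_rhs => rw [← Complex.re_add_im v]
  ring

theorem dbar_comp_sub_const (g : ℂ → ℂ) (z w : ℂ) :
    dbar (fun w => g (w - z)) w = dbar g (w - z) := by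
  simp only [dbar, fderiv_comp_sub]

/-- The radial weight whose integral is the constant in the Cauchy-Pompeiu formula. -/
noncomputable def radialWeight (v : ℂ) : ℝ := 2 * deriv Real.smoothTransition (2 - Complex.normSq v)

theorem continuous_radialWeight : Continuous radialWeight :=
  continuous_const.mul (((Real.smoothTransition.contDiff (n := 1)).continuous_deriv le_rfl).comp
    (continuous_const.sub Complex.continuous_normSq))

theorem deriv_smoothTransition_eq_zero_of_neg {x : ℝ} (hx : x < 0) :
    deriv Real.smoothTransition x = 0 := by
  have : Real.smoothTransition =ᶠ[nhds x] fun _ => 0 := by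
    filter_upwards [Iio_mem_nhds hx] with y hy
    exact Real.smoothTransition.zero_of_nonpos (Set.mem_Iio.mp hy).le
  rw [this.deriv_eq, deriv_const]

theorem hasCompactSupport_radialWeight : HasCompactSupport radialWeight := by
  refine HasCompactSupport.intro (isCompact_closedBall 0 2) fun v hv => ?_
  rw [mem_closedBall_zero_iff, not_le] at hv
  have : 2 - Complex.normSq v < 0 := by
    rw [Complex.normSq_eq_norm_sq]
    nlinarith
  simp [radialWeight, deriv_smoothTransition_eq_zero_of_neg this]

-- The exact constant is irrelevant; it only has to be nonzero so that the formula can be solved for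
-- `f z`.
open MeasureTheory in
theorem integral_radialWeight_pos : 0 < ∫ v, radialWeight v := by
  obtain ⟨x, hx, hd⟩ : ∃ x ∈ Set.Ioo (0 : ℝ) 1,
      deriv Real.smoothTransition x = (1 - 0) / (1 - 0) := by
    have := exists_deriv_eq_slope Real.smoothTransition (zero_lt_one (α := ℝ))
      Real.smoothTransition.continuous.continuousOn
      ((Real.smoothTransition.contDiff (n := 1)).differentiable one_ne_zero).differentiableOn
    simpa using this
  -- At `v = √(2 - x)` one has `2 - |v|² = x`, the point where the mean value theorem gives slope
  -- `1`.
  refine continuous_radialWeight.integral_pos_of_hasCompactSupport_nonneg_nonzero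
    hasCompactSupport_radialWeight (fun v => ?_) (x := (√(2 - x) : ℂ)) ?_
  · exact mul_nonneg zero_le_two Real.smoothTransition.monotone.deriv_nonneg
  · have : 2 - √(2 - x) * √(2 - x) = x := by
      rw [Real.mul_self_sqrt (by linarith [hx.2])]
      ring
    rw [radialWeight, Complex.normSq_ofReal, this, hd]
    norm_num

theorem continuous_mul_inv_sub {K : Set ℂ} {g : ℂ → ℂ} (hg : Continuous g)
    (hK : Disjoint K (tsupport g)) : Continuous fun p : ℂ × K => g p.1 * (p.1 - p.2)⁻¹ := by
  rw [continuous_iff_continuousAt]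
  rintro ⟨w, z⟩
  by_cases h : w = z
  · have hw : w ∉ tsupport g := Set.disjoint_left.mp hK (h ▸ z.2)
    have h0 : (fun p : ℂ × K => g p.1 * (p.1 - p.2)⁻¹) =ᶠ[nhds (w, z)] fun _ => 0 := by
      filter_upwards [continuousAt_fst.eventually (notMem_tsupport_iff_eventuallyEq.mp hw)] with p hp
      simp [hp]
    exact h0.continuousAt
  · refine (hg.comp continuous_fst).continuousAt.mul (ContinuousAt.inv₀ ?_ (sub_ne_zero.mpr h))
    fun_prop

open MeasureTheory in
/-- The **Cauchy-Pompeiu formula** for a product of a holomorphic function and a cutoff. -/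
theorem integral_dbar_mul_inv_sub {Ω : Set ℂ} (hΩ : IsOpen Ω) {f χ : ℂ → ℂ}
    (hf : DifferentiableOn ℂ f Ω) (hχ : ContDiff ℝ 1 χ) (hχc : HasCompactSupport χ)
    (hχΩ : tsupport χ ⊆ Ω) {z : ℂ} (hz : z ∈ Ω) (hχz : χ =ᶠ[nhds z] fun _ => 1) :
    ∫ w, dbar χ w * f w * (w - z)⁻¹ = ((-∫ v, radialWeight v : ℝ) : ℂ) * f z := by
  set u : ℂ → ℂ := fun w => χ w * f w with hu
  have hu0 {w : ℂ} (hw : w ∉ Ω) : u =ᶠ[nhds w] fun _ => 0 := by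
    filter_upwards [notMem_tsupport_iff_eventuallyEq.mp fun h => hw (hχΩ h)] with y hy
    simp [hu, hy]
  have huC : ContDiff ℝ 1 u := by
    refine contDiff_iff_contDiffAt.mpr fun w => ?_
    by_cases hw : w ∈ Ω
    · exact hχ.contDiffAt.mul
        ((hf.analyticAt (hΩ.mem_nhds hw)).contDiffAt.restrict_scalars ℝ)
    · exact contDiffAt_const.congr_of_eventuallyEq (hu0 hw)
  have hudbar (w : ℂ) : dbar u w = dbar χ w * f w := by
    by_cases hw : w ∈ Ω
    · exact dbar_mul_of_differentiableAt (hχ.differentiable one_ne_zero w)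
        (hf.differentiableAt (hΩ.mem_nhds hw))
    · rw [dbar_congr (hu0 hw), dbar_const, dbar_eq_zero_of_notMem_tsupport fun h => hw (hχΩ h),
        zero_mul]
  set ρ : ℂ → ℂ := fun w => radialCutoff (w - z) * f z with hρ
  have hρC : ContDiff ℝ 1 ρ :=
    (contDiff_radialCutoff.comp (contDiff_id.sub contDiff_const)).mul contDiff_const
  have hρdbar (w : ℂ) : dbar ρ w = -(radialWeight (w - z) : ℂ) * (w - z) * f z := by
    have hd : DifferentiableAt ℝ (fun w => radialCutoff (w - z)) w :=
      (contDiff_radialCutoff.comp (contDiff_id.sub contDiff_const)).differentiable one_ne_zero w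
    rw [hρ, dbar_mul_of_differentiableAt hd (differentiableAt_const _), dbar_comp_sub_const,
      dbar_radialCutoff, radialWeight]
    push_cast
    ring
  -- Subtracting `ρ` makes `q` vanish at `z` and holomorphic near it, so `q / (w - z)` extends to a
  -- `C¹` function with compact support, whose `dbar` integrates to zero.
  set q : ℂ → ℂ := fun w => u w - ρ w with hq
  have hqC : ContDiff ℝ 1 q := huC.sub hρC
  have hqz : q =ᶠ[nhds z] fun w => f w - f z := by
    have h1 : Filter.Tendsto (fun w => w - z) (nhds z) (nhds 0) :=
      tendsto_sub_nhds_zero_iff.mpr Filter.tendsto_id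
    filter_upwards [hχz, h1.eventually radialCutoff_eventuallyEq_one] with w hw hw'
    simp [hq, hu, hρ, hw, hw']
  have hqz0 : q z = 0 := by simpa using hqz.self_of_nhds
  have hqc : HasCompactSupport q := by
    refine (hχc.mul_right (f' := f)).sub (HasCompactSupport.mul_right ?_)
    exact hasCompactSupport_radialCutoff.comp_homeomorph (Homeomorph.subRight z)
  set h : ℂ → ℂ := dslope q z with hh
  have hne {w : ℂ} (hw : w ≠ z) : h w = q w * (w - z)⁻¹ := by
    rw [hh, dslope_of_ne _ hw, slope_def_field, hqz0, sub_zero, div_eq_mul_inv]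
  have hevne {w : ℂ} (hw : w ≠ z) : h =ᶠ[nhds w] fun w => q w * (w - z)⁻¹ := by
    filter_upwards [isOpen_ne.mem_nhds hw] with y hy using hne hy
  have hC : ContDiff ℝ 1 h := by
    refine contDiff_iff_contDiffAt.mpr fun w => ?_
    by_cases hw : w = z
    · subst hw
      have h1 : h =ᶠ[nhds w] dslope (fun y => f y - f w) w := by
        filter_upwards [hqz] with y hy
        by_cases hyw : y = w
        · rw [hyw, hh, dslope_same, dslope_same, hqz.deriv_eq]
        · rw [hne hyw, dslope_of_ne _ hyw, slope_def_field, hy, sub_self, sub_zero,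
            div_eq_mul_inv]
      have h2 : DifferentiableOn ℂ (dslope (fun y => f y - f w) w) Ω :=
        (Complex.differentiableOn_dslope (hΩ.mem_nhds hz)).mpr (hf.sub_const _)
      exact ((h2.analyticAt (hΩ.mem_nhds hz)).contDiffAt.restrict_scalars ℝ).congr_of_eventuallyEq h1
    · refine ContDiffAt.congr_of_eventuallyEq ?_ (hevne hw)
      exact hqC.contDiffAt.mul ((contDiffAt_id.sub contDiffAt_const).inv (sub_ne_zero.mpr hw))
  have hc : HasCompactSupport h := by
    refine HasCompactSupport.intro (hqc.isCompact.insert z) fun w hw => ?_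
    rw [Set.mem_insert_iff, not_or] at hw
    rw [hne hw.1, image_eq_zero_of_notMem_tsupport hw.2, zero_mul]
  have hhdbar {w : ℂ} (hw : w ≠ z) :
      dbar h w = dbar χ w * f w * (w - z)⁻¹ + (radialWeight (w - z) : ℂ) * f z := by
    have hd : DifferentiableAt ℂ (fun w : ℂ => (w - z)⁻¹) w :=
      (differentiableAt_id.sub_const z).inv (sub_ne_zero.mpr hw)
    rw [dbar_congr (hevne hw),
      dbar_mul_of_differentiableAt (hqC.differentiable one_ne_zero w) hd, hq,
      dbar_sub (huC.differentiable one_ne_zero w) (hρC.differentiable one_ne_zero w),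
      hudbar, hρdbar]
    have := sub_ne_zero.mpr hw
    field_simp
    ring
  have hzero := integral_dbar_eq_zero hC hc
  have hae : dbar h =ᵐ[volume]
      fun w => dbar χ w * f w * (w - z)⁻¹ + (radialWeight (w - z) : ℂ) * f z := by
    filter_upwards [compl_mem_ae_iff.mpr (measure_singleton (μ := (volume : Measure ℂ)) z)]
      with w hw using hhdbar hw
  have hcont : Continuous fun w => dbar χ w * f w := by
    rw [← funext hudbar]
    exact continuous_dbar huC
  have hsupp : z ∉ tsupport fun w => dbar χ w * f w := by
    rw [notMem_tsupport_iff_eventuallyEq]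
    filter_upwards [hχz.eventuallyEq_nhds] with w hw
    simp [dbar_congr hw, dbar_const]
  have hint1 : Integrable fun w => dbar χ w * f w * (w - z)⁻¹ := by
    refine Continuous.integrable_of_hasCompactSupport ?_
      ((hχc.dbar.mul_right (f' := f)).mul_right (f' := fun w => (w - z)⁻¹))
    exact (continuous_mul_inv_sub hcont (Set.disjoint_singleton_left.mpr hsupp)).comp
      (f := fun w => ((w, ⟨z, rfl⟩) : ℂ × ({z} : Set ℂ))) (by fun_prop)
  have hint2 : Integrable fun w => (radialWeight (w - z) : ℂ) :=
    ((continuous_radialWeight.integrable_of_hasCompactSupport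
      hasCompactSupport_radialWeight).comp_sub_right z).ofReal
  rw [integral_congr_ae hae, integral_add hint1 (hint2.mul_const _), integral_mul_const,
    integral_sub_right_eq_self (fun w => (radialWeight w : ℂ)) z, integral_complex_ofReal] at hzero
  push_cast
  linear_combination hzero

/-! ### Runge's theorem -/

/-- The spectrum of the coordinate function is `K` in `C(K, ℂ)`. Passing to a closed subalgebra can
only add points in bounded components of the complement, so off the hull `w - X` is already
invertible in the closure of the polynomials. -/
theorem inv_sub_mem_closure_polynomialFunctions {K : Set ℂ} [CompactSpace K] {w : ℂ}
    (hw : w ∉ polynomialHull K) {g : C(K, ℂ)} (hg : ∀ z : K, g z = (w - z)⁻¹) :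
    g ∈ (polynomialFunctions K).topologicalClosure := by
  set S := (polynomialFunctions K).topologicalClosure with hS
  have : IsClosed (S : Set C(K, ℂ)) := Subalgebra.isClosed_topologicalClosure _
  have hwK : w ∉ K := fun h => hw (subset_polynomialHull K h)
  have hXS : Polynomial.X.toContinuousMapOn K ∈ S :=
    Subalgebra.le_topologicalClosure _ ⟨Polynomial.X, trivial, rfl⟩
  have hspec : w ∉ spectrum ℂ (⟨_, hXS⟩ : S) := fun h => hw <| by
    have := Subalgebra.spectrum_isBounded_connectedComponentIn S _ h
    simpa [polynomialHull, ContinuousMap.spectrum_eq_range, Set.range] using this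
  obtain ⟨u, hu⟩ := spectrum.notMem_iff.mp hspec
  have hmul : ((u⁻¹ : Sˣ) : S).1 * (u : S).1 = 1 := by
    rw [← MulMemClass.coe_mul, Units.inv_mul]
    rfl
  convert ((u⁻¹ : Sˣ) : S).2
  ext z
  have h1 := congrArg (fun f : C(K, ℂ) => f z) hmul
  have h2 : (u : S).1 z = w - z := by
    rw [hu]
    simp [Algebra.algebraMap_eq_smul_one]
  rw [ContinuousMap.mul_apply, h2] at h1
  rw [hg z]
  exact (eq_inv_of_mul_eq_one_left h1).symm

open MeasureTheory in
/-- **Runge's theorem** for simply connected open sets. -/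
theorem IsSimplyConnected.mem_closure_polynomialFunctions {Ω K : Set ℂ} (hΩ : IsOpen Ω)
    (hsc : IsSimplyConnected Ω) [CompactSpace K] (hKΩ : K ⊆ Ω) {f : ℂ → ℂ}
    (hf : DifferentiableOn ℂ f Ω) {g : C(K, ℂ)} (hg : ∀ z : K, g z = f z) :
    g ∈ (polynomialFunctions K).topologicalClosure := by
  set S := (polynomialFunctions K).topologicalClosure with hS
  have hSc : IsClosed (S : Set C(K, ℂ)) := Subalgebra.isClosed_topologicalClosure _
  have : CompleteSpace S := hSc.completeSpace_coe
  have hK : IsCompact K := isCompact_iff_compactSpace.mpr inferInstance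
  obtain ⟨t, htc, hKt, htΩ⟩ := exists_compact_between (isCompact_polynomialHull hK) hΩ
    (hsc.polynomialHull_subset hΩ hK hKΩ)
  obtain ⟨χ₀, hχ1, hχ0, -⟩ := exists_contMDiffMap_one_nhds_of_subset_interior (n := 1)
    (modelWithCornersSelf ℝ ℂ) (isCompact_polynomialHull hK).isClosed hKt
  set χ : ℂ → ℂ := fun w => (χ₀ w : ℂ) with hχdef
  have hχ : ContDiff ℝ 1 χ := Complex.ofRealCLM.contDiff.comp χ₀.contMDiff.contDiff
  have hχt : tsupport χ ⊆ t :=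
    closure_minimal (fun w hw => by_contra fun h => hw (by simp [hχdef, hχ0 w h])) htc.isClosed
  have hχc : HasCompactSupport χ := htc.of_isClosed_subset (isClosed_tsupport χ) hχt
  have hχone {z : ℂ} (hz : z ∈ polynomialHull K) : χ =ᶠ[nhds z] fun _ => 1 := by
    filter_upwards [eventually_nhdsSet_iff_forall.mp hχ1 z hz] with w hw
    simp [hχdef, hw]
  set p : ℂ → ℂ := fun w => dbar χ w * f w with hp
  have hp0 {w : ℂ} (hw : w ∉ tsupport χ) : p =ᶠ[nhds w] fun _ => 0 := by
    filter_upwards [(isClosed_tsupport χ).isOpen_compl.mem_nhds hw] with y hy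
    simp [hp, dbar_eq_zero_of_notMem_tsupport hy]
  have hp0' {w : ℂ} (hw : w ∈ polynomialHull K) : p =ᶠ[nhds w] fun _ => 0 := by
    filter_upwards [(hχone hw).eventuallyEq_nhds] with y hy
    simp [hp, dbar_congr hy, dbar_const]
  have hpc : Continuous p := by
    refine continuous_iff_continuousAt.mpr fun w => ?_
    by_cases hw : w ∈ tsupport χ
    · exact (continuous_dbar hχ).continuousAt.mul
        (hf.differentiableAt (hΩ.mem_nhds (htΩ (hχt hw)))).continuousAt
    · exact (hp0 hw).continuousAt
  have hdisj : Disjoint K (tsupport p) := Set.disjoint_left.mpr fun z hz =>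
    notMem_tsupport_iff_eventuallyEq.mpr (hp0' (subset_polynomialHull K hz))
  -- The Cauchy-Pompeiu integrand as a continuous family of functions on `K`. It takes values in the
  -- closed subspace `S`, so its Bochner integral can be formed inside `S`.
  set G : C(ℂ, C(K, ℂ)) := ContinuousMap.curry ⟨_, continuous_mul_inv_sub hpc hdisj⟩ with hG
  have hGapp (w : ℂ) (z : K) : G w z = p w * (w - z)⁻¹ := rfl
  have hGS (w : ℂ) : G w ∈ S := by
    by_cases hw : w ∈ polynomialHull K
    · convert S.zero_mem
      ext z
      simp [hGapp, (hp0' hw).self_of_nhds]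
    · by_cases hpw : p w = 0
      · convert S.zero_mem
        ext z
        simp [hGapp, hpw]
      · have : G w = p w • ((p w)⁻¹ • G w) := by rw [smul_inv_smul₀ hpw]
        rw [this]
        refine S.smul_mem (inv_sub_mem_closure_polynomialFunctions hw fun z => ?_) _
        simp [hGapp, hpw]
  have hint : Integrable fun w => (⟨G w, hGS w⟩ : S) := by
    refine Continuous.integrable_of_hasCompactSupport (by fun_prop) ?_
    refine HasCompactSupport.intro hχc.isCompact fun w hw => ?_
    ext z
    simp [hGapp, (hp0 hw).self_of_nhds]
  set c : ℂ := ((-∫ v, radialWeight v : ℝ) : ℂ) with hc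
  have hc0 : c ≠ 0 := Complex.ofReal_ne_zero.mpr (neg_ne_zero.mpr integral_radialWeight_pos.ne')
  have hval (z : K) : (∫ w, (⟨G w, hGS w⟩ : S) : S).1 z = c * f z := by
    let L : S →L[ℂ] ℂ := (ContinuousMap.evalCLM ℂ z).comp (S.toSubmodule.subtypeL)
    have h1 : L (∫ w, (⟨G w, hGS w⟩ : S)) = ∫ w, L ⟨G w, hGS w⟩ :=
      (L.integral_comp_comm hint).symm
    have h2 := integral_dbar_mul_inv_sub hΩ hf hχ hχc (hχt.trans htΩ) (hKΩ z.2)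
      (hχone (subset_polynomialHull K z.2))
    exact h1.trans h2
  have : g = c⁻¹ • (∫ w, (⟨G w, hGS w⟩ : S) : S).1 := by
    ext z
    rw [ContinuousMap.smul_apply, hval, hg, smul_eq_mul, inv_mul_cancel_left₀ hc0]
  rw [this]
  exact S.smul_mem (Subtype.mem _) _

/-! ### From polynomials to Dirichlet polynomials -/

theorem differentiable_dirichletPolynomial (N : ℕ) (a : ℕ → ℂ) :
    Differentiable ℂ (dirichletPolynomial N a) := by
  unfold dirichletPolynomial
  refine Differentiable.fun_sum fun n hn => ?_
  have hn0 : (n : ℂ) ≠ 0 := Nat.cast_ne_zero.mpr (by have := (Finset.mem_Icc.mp hn).1; omega)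
  exact (differentiable_neg.const_cpow (Or.inl hn0)).const_mul _

/-- The span of the functions `s ↦ n ^ (-s)` on a compact set. -/
noncomputable def dirichletSpan (K : Set ℂ) [CompactSpace K] : Submodule ℂ C(K, ℂ) :=
  Submodule.span ℂ (Set.range fun n : ℕ =>
    NormedSpace.exp (-(Real.log (n + 1) : ℂ) • Polynomial.X.toContinuousMapOn K))

theorem exp_neg_log_smul_X_apply (K : Set ℂ) [CompactSpace K] (n : ℕ) (s : K) :
    NormedSpace.exp (-(Real.log (n + 1) : ℂ) • Polynomial.X.toContinuousMapOn K) s =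
      ((n + 1 : ℕ) : ℂ) ^ (-(s : ℂ)) := by
  let _ : NormedAlgebra ℚ C(K, ℂ) := NormedAlgebra.restrictScalars ℚ ℂ C(K, ℂ)
  have h := NormedSpace.map_exp (ContinuousMap.evalAlgHom ℂ ℂ s)
    (continuous_eval_const s)
    (-(Real.log (n + 1) : ℂ) • Polynomial.X.toContinuousMapOn K)
  refine Eq.trans h ?_
  rw [← Complex.exp_eq_exp_ℂ, Complex.cpow_def_of_ne_zero (by exact_mod_cast n.succ_ne_zero)]
  congr 1
  simp [Complex.ofReal_log (show (0 : ℝ) ≤ n + 1 by positivity)]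

theorem exists_dirichletPolynomial_of_mem_dirichletSpan {K : Set ℂ} [CompactSpace K]
    {g : C(K, ℂ)} (hg : g ∈ dirichletSpan K) :
    ∃ (N : ℕ) (a : ℕ → ℂ), ∀ s : K, g s = dirichletPolynomial N a s := by
  obtain ⟨c, rfl⟩ := Finsupp.mem_span_range_iff_exists_finsupp.mp hg
  obtain ⟨N, hN⟩ := c.support.exists_nat_subset_range
  -- The spanning family starts at index `0` with `1 ^ (-s)`, hence the shift.
  refine ⟨N, fun n => c (n - 1), fun s => ?_⟩
  rw [Finsupp.sum_of_support_subset c hN _ (by simp), dirichletPolynomial, Finset.range_eq_Ico,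
    ContinuousMap.sum_apply, ← Finset.Ico_succ_right_eq_Icc, Order.succ_eq_add_one,
    Finset.sum_Ico_eq_sum_range _ 1, ← Finset.range_eq_Ico]
  refine Finset.sum_congr (by simp) fun n _ => ?_
  rw [ContinuousMap.smul_apply, exp_neg_log_smul_X_apply, add_comm 1 n]
  simp

theorem polynomialFunctions_closure_subset (K : Set ℂ) [CompactSpace K] :
    ((polynomialFunctions K).topologicalClosure : Set C(K, ℂ)) ⊆
      (dirichletSpan K).topologicalClosure := by
  refine closure_minimal ?_ (Submodule.isClosed_topologicalClosure _)
  change (polynomialFunctions K : Set C(K, ℂ)) ⊆ _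
  rw [polynomialFunctions_coe]
  rintro _ ⟨P, rfl⟩
  induction P using Polynomial.induction_on' with
  | add P Q hP hQ =>
    rw [map_add]
    exact add_mem hP hQ
  | monomial n a =>
    rw [← Polynomial.C_mul_X_pow_eq_monomial, ← Polynomial.smul_eq_C_mul, map_smul, map_pow]
    refine Submodule.smul_mem _ _ ?_
    -- For empty `K` the algebra is trivial and `‖1‖ = 1` fails.
    rcases isEmpty_or_nonempty K with hK | hK
    · rw [Subsingleton.elim (Polynomial.toContinuousMapOnAlgHom K Polynomial.X ^ n) 0]
      exact zero_mem _
    · exact pow_mem_closure_span_exp_neg_log _ n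

theorem mainTheorem8 (Ω : Set ℂ) (hΩ : IsOpen Ω) (hsc : IsSimplyConnected Ω) :
    Dense (dirichletPolynomials Ω) := by
  rintro ⟨f, F, hF, hfF⟩
  rw [mem_closure_iff_nhds]
  intro t ht
  obtain ⟨u, hu, hut⟩ := mem_nhds_subtype _ _ _ |>.mp ht
  obtain ⟨⟨K, ε⟩, ⟨hK, hε⟩, hKu⟩ := (nhds_basis_uniformity'
    Metric.uniformity_basis_dist.compactConvergenceUniformity).mem_iff.mp hu
  have : CompactSpace (Subtype.val '' K : Set ℂ) :=
    isCompact_iff_compactSpace.mp (hK.image continuous_subtype_val)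
  have hKΩ : (Subtype.val '' K : Set ℂ) ⊆ Ω := Subtype.coe_image_subset Ω K
  let g : C((Subtype.val '' K : Set ℂ), ℂ) :=
    ⟨_, continuousOn_iff_continuous_domRestrict.mp (hF.continuousOn.mono hKΩ)⟩
  have hg : g ∈ (dirichletSpan (Subtype.val '' K)).topologicalClosure :=
    polynomialFunctions_closure_subset _
      (hsc.mem_closure_polynomialFunctions hΩ hKΩ hF fun _ => rfl)
  obtain ⟨d, hd, hgd⟩ := Metric.mem_closure_iff.mp hg ε hε
  obtain ⟨N, a, hda⟩ := exists_dirichletPolynomial_of_mem_dirichletSpan hd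
  have hP := differentiable_dirichletPolynomial N a
  refine ⟨⟨⟨fun s => dirichletPolynomial N a s, hP.continuous.comp continuous_subtype_val⟩,
    dirichletPolynomial N a, hP.differentiableOn, fun _ => rfl⟩, hut (hKu fun s hs => ?_),
    N, a, fun _ => rfl⟩
  have h1 := (ContinuousMap.dist_lt_iff hε).mp hgd ⟨s, s, hs, rfl⟩
  rw [hda] at h1
  change dist (f s) (dirichletPolynomial N a s) < ε
  rw [hfF]
  exact h1
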